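/- Let $G=(V,E)$ be a finite simple undirected graph. For a set $D\subseteq V$ put $D_0=D$ and, for $i\ge 0$, let $D_{i+1}$ be the set of all vertices $v$ that have at least $t(v)=\lceil(\deg(v)+1)/2\rceil$ neighbours in $D_0\cup\dots\cup D_i$; call $D$ a strict majority dynamo of $G$ if $\bigcup_{i\ge 0}D_i=V$. Let $\alpha'(G)$ denote the matching number of $G$, i.e. the maximum number of pairwise disjoint edges of $G$. If $G$ is connected, then $G$ has a strict majority dynamo of size at most $\alpha'(G)+1$. More generally, if $G$ has $c$ connected components, then $G$ has a strict majority dynamo of size at most $\alpha'(G)+c$. -/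

import Mathlib

namespace SimpleGraph

/-- The vertices that are active after `i` steps of the dynamic process with thresholds `τ` started
from `D`, i.e. the union `D₀ ∪ … ∪ Dᵢ`, where `D₀ = D` and `Dᵢ₊₁` consists of all vertices `v` with
at least `τ v` neighbours in `D₀ ∪ … ∪ Dᵢ`. -/
def activeAfter {V : Type*} (G : SimpleGraph V) (τ : V → ℕ) (D : Set V) : ℕ → Set V
  | 0 => D
  | i + 1 => activeAfter G τ D i ∪ {v | τ v ≤ (G.neighborSet v ∩ activeAfter G τ D i).ncard}

/-- `D` is a `τ`-dynamic monopoly (dynamo) of `G`: every vertex eventually becomes active. -/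
def IsDynamo {V : Type*} (G : SimpleGraph V) (τ : V → ℕ) (D : Set V) : Prop :=
  ⋃ i, G.activeAfter τ D i = Set.univ

/-- The strict majority threshold `⌈(deg v + 1) / 2⌉`. -/
def strictMajorityThreshold {V : Type*} (G : SimpleGraph V) [G.LocallyFinite] (v : V) : ℕ :=
  ⌈((G.degree v : ℚ) + 1) / 2⌉₊

/-- A strict majority dynamo of `G`. -/
def IsStrictMajorityDynamo {V : Type*} (G : SimpleGraph V) [G.LocallyFinite] (D : Set V) : Prop :=
  G.IsDynamo G.strictMajorityThreshold D

/-- The matching number `α'(G)`: the largest number of edges in a matching of `G`.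
For a finite graph the maximum is attained, see `isGreatest_matchingNumber`. -/
noncomputable def matchingNumber {V : Type*} (G : SimpleGraph V) : ℕ :=
  sSup {n | ∃ M : G.Subgraph, M.IsMatching ∧ M.edgeSet.ncard = n}

theorem isGreatest_matchingNumber {V : Type*} [Finite V] (G : SimpleGraph V) :
    IsGreatest {n | ∃ M : G.Subgraph, M.IsMatching ∧ M.edgeSet.ncard = n} G.matchingNumber := by
  have hb : BddAbove {n | ∃ M : G.Subgraph, M.IsMatching ∧ M.edgeSet.ncard = n} := by
    refine ⟨G.edgeSet.ncard, ?_⟩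
    rintro n ⟨M, -, rfl⟩
    exact Set.ncard_le_ncard M.edgeSet_subset (Set.toFinite _)
  refine ⟨Nat.sSup_mem ⟨0, ⊥, ?_, by simp⟩ hb, fun n hn => le_csSup hb hn⟩
  intro v hv
  simp at hv

end SimpleGraph

/-! By Tutte–Berge there is `U` such that, with `H` obtained from `G` by deleting all edges meeting
`U`, `U.ncard` plus the sum of `⌊|c|/2⌋` over the components `c` of `H` is at most the matching
number (`exists_two_mul_ncard_add_card_le`). Activate `U` and the smaller side, in each component of
`H`, of a suitable cut. The cut is locally maximal, so no vertex has a majority of its neighbours on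
its own side; ties are broken so that a tied non-root sits with its parent in a spanning forest
(`exists_cut_tie_parent`). If a nonempty set of inactive vertices were stuck, its vertex nearest the
root would be tied with all its own-side neighbours in the set, hence with its parent in it,
contradicting minimality. Only roots escape this argument. A root adjacent to `U` gains degree in
`G`, which breaks the tie; a component of `H` not touching `U` is a component of `G`, and its root
is activated at extra cost one. -/

namespace SimpleGraph

/-! ### Locally optimal cuts with tie-breaking -/

open Finset in
/-- A quadratic form with symmetric coefficients and zero diagonal has a sign vector that no single
sign change improves. -/
theorem exists_signs_sum_mul_nonpos {V : Type*} [Fintype V] (a : V → V → ℤ)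
    (hsymm : ∀ u v, a u v = a v u) (hdiag : ∀ u, a u u = 0) :
    ∃ s : V → ℤˣ, ∀ x, ∑ v, a x v * ((s x : ℤ) * s v) ≤ 0 := by
  classical
  obtain ⟨s, hs⟩ := Finite.exists_min fun s : V → ℤˣ => ∑ u, ∑ v, a u v * ((s u : ℤ) * s v)
  refine ⟨s, fun x => ?_⟩
  -- By symmetry and the zero diagonal, flipping the sign of `x` in a minimizer adds −4 times the
  -- sum in question.
  have h := hs (Function.update s x (-s x))
  have hupd : ∀ v, ((Function.update s x (-s x) v : ℤˣ) : ℤ)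
      = s v - (if v = x then 2 * (s x : ℤ) else 0) := by
    intro v
    by_cases hv : v = x
    · subst hv; simp; ring
    · simp [hv]
  have hexp : ∀ u v, a u v * ((s u - (if u = x then 2 * (s x : ℤ) else 0)) *
      (s v - (if v = x then 2 * (s x : ℤ) else 0))) =
      a u v * ((s u : ℤ) * s v) - (if u = x then 2 * (a x v * ((s x : ℤ) * s v)) else 0)
        - (if v = x then 2 * (a x u * ((s x : ℤ) * s u)) else 0) := by
    intro u v
    by_cases hu : u = x <;> by_cases hv : v = x
    · subst hu; subst hv; simp [hdiag]
    · subst hu; simp [hv]; ring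
    · subst hv; simp [hu, hsymm u v]; ring
    · simp [hu, hv]
  simp only [hupd, hexp, sum_sub_distrib, sum_ite_eq', mem_univ, if_true] at h
  rw [sum_comm (f := fun u v => if u = x then 2 * (a x v * ((s x : ℤ) * s v)) else 0)] at h
  simp only [sum_ite_eq', mem_univ, if_true, ← mul_sum] at h
  linarith

open Finset in
/-- Given a rooted spanning forest with parent function `p` and heights `h`, there is a cut in which
every vertex has at least as many neighbours across as on its own side, and every non-root vertex
for which the two numbers agree lies on the side of its parent. -/
theorem exists_cut_tie_parent {V : Type*} [Fintype V] (H : SimpleGraph V) [DecidableRel H.Adj]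
    (R : Set V) (h : V → ℕ) (p : V → V) (hadj : ∀ v, v ∉ R → H.Adj v (p v))
    (hlt : ∀ v, v ∉ R → h (p v) < h v) :
    ∃ s : V → ℤˣ, ∀ v, #{w | H.Adj v w ∧ s w = s v} ≤ #{w | H.Adj v w ∧ s w ≠ s v} ∧
      (#{w | H.Adj v w ∧ s w = s v} = #{w | H.Adj v w ∧ s w ≠ s v} → v ∉ R → s (p v) = s v) := by
  classical
  -- With this base, the weight of the edge from a vertex to its parent exceeds the total weight of
  -- the edges to its children, which lie higher.
  set N : ℤ := Fintype.card V + 1 with hN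
  set L : ℕ := ∑ v, h v with hL
  have hle : ∀ v, h v ≤ L := fun v => single_le_sum (fun _ _ => Nat.zero_le _) (mem_univ v)
  have hN0 : 0 < N := by positivity
  set q : V → V → ℤ := fun u v => if u ∉ R ∧ p u = v then N ^ (L - h u) else 0 with hq
  have hq0 : ∀ u v, 0 ≤ q u v := by
    intro u v; simp only [hq]; split_ifs <;> positivity
  have hqd : ∀ u, q u u = 0 := by
    intro u; simp only [hq]; rw [if_neg]
    rintro ⟨h1, h2⟩
    exact (hadj u h1).ne h2.symm
  set w : V → V → ℤ := fun u v => q u v + q v u with hw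
  have hw0 : ∀ u v, 0 ≤ w u v := fun u v => add_nonneg (hq0 _ _) (hq0 _ _)
  -- `M` exceeds every row sum of `w`, so the perturbation decides ties only.
  set M : ℤ := 1 + ∑ u, ∑ v, w u v with hM
  have hrow : ∀ x, ∑ v, w x v < M := by
    intro x
    have := single_le_sum (f := fun u => ∑ v, w u v)
      (fun u _ => sum_nonneg fun v _ => hw0 u v) (mem_univ x)
    linarith
  obtain ⟨s, hs⟩ := exists_signs_sum_mul_nonpos
    (fun u v => (if H.Adj u v then M else 0) - w u v)
    (fun u v => by simp only [hw, H.adj_comm]; ring) (fun u => by simp [hw, hqd])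
  have hmul : ∀ x v, ((s x : ℤ) * s v) = if s v = s x then 1 else -1 := by
    intro x v
    rcases Int.units_eq_one_or (s x) with h1 | h1 <;>
      rcases Int.units_eq_one_or (s v) with h2 | h2 <;> rw [h1, h2] <;> decide
  have hkey : ∀ x, M * ((#{v | H.Adj x v ∧ s v = s x} : ℤ) - #{v | H.Adj x v ∧ s v ≠ s x})
      ≤ ∑ v, w x v * ((s x : ℤ) * s v) := by
    intro x
    have h1 := hs x
    simp only [sub_mul, sum_sub_distrib] at h1
    have h2 : ∑ v, (if H.Adj x v then M else 0) * ((s x : ℤ) * s v) =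
        M * ((#{v | H.Adj x v ∧ s v = s x} : ℤ) - #{v | H.Adj x v ∧ s v ≠ s x}) := by
      rw [card_filter, card_filter]
      push_cast
      rw [← sum_sub_distrib, mul_sum]
      refine sum_congr rfl fun v _ => ?_
      rw [hmul]
      by_cases h3 : H.Adj x v <;> by_cases h4 : s v = s x <;> simp [h3, h4]
    linarith
  refine ⟨s, fun x => ⟨?_, fun heq hx => ?_⟩⟩
  · by_contra! hcon
    have h1 : ∑ v, w x v * ((s x : ℤ) * s v) ≤ ∑ v, w x v := by
      refine sum_le_sum fun v _ => ?_
      rw [hmul]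
      have := hw0 x v
      split_ifs <;> linarith
    have h2 : (1 : ℤ) ≤ (#{v | H.Adj x v ∧ s v = s x} : ℤ) - #{v | H.Adj x v ∧ s v ≠ s x} := by
      have : (#{v | H.Adj x v ∧ s v ≠ s x} : ℤ) + 1 ≤ #{v | H.Adj x v ∧ s v = s x} := by
        exact_mod_cast hcon
      linarith
    have h3 := hrow x
    have h4 : 0 ≤ M := le_trans (sum_nonneg fun v _ => hw0 x v) h3.le
    nlinarith [hkey x]
  · by_contra hne
    have h1 := hkey x
    rw [heq, sub_self, mul_zero] at h1
    simp only [hw, add_mul, sum_add_distrib] at h1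
    have h2 : ∑ v, q x v * ((s x : ℤ) * s v) = - N ^ (L - h x) := by
      rw [sum_eq_single (p x)]
      · rw [hmul, if_neg hne]; simp [hq, hx]
      · intro b _ hb
        simp [hq, hb.symm]
      · simp
    have h3 : ∑ v, q v x * ((s x : ℤ) * s v) ≤ ∑ _v : V, N ^ (L - h x - 1) := by
      refine sum_le_sum fun v _ => ?_
      have hb : q v x ≤ N ^ (L - h x - 1) := by
        simp only [hq]
        split_ifs with hv
        · have := hlt v hv.1
          rw [hv.2] at this
          exact pow_le_pow_right₀ (by omega) (by omega)
        · positivity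
      rw [hmul]
      have := hq0 v x
      split_ifs <;> linarith
    have hlx := hlt x hx
    rw [sum_const, card_univ, nsmul_eq_mul] at h3
    -- Here the truncated exponent makes `h3` useless, but a vertex of maximal height `L` has no
    -- children.
    by_cases hLx : L - h x = 0
    · have h4 : ∑ v, q v x * ((s x : ℤ) * s v) ≤ 0 := by
        refine sum_nonpos fun v _ => ?_
        have : q v x = 0 := by
          simp only [hq]
          rw [if_neg]
          rintro ⟨hv, hv'⟩
          have h5 := hlt v hv
          rw [hv'] at h5
          have := hle v
          omega
        simp [this]
      rw [hLx] at h2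
      simp at h2
      linarith
    · obtain ⟨k, hk⟩ := Nat.exists_eq_succ_of_ne_zero hLx
      rw [hk] at h2 h3
      simp only [Nat.succ_eq_add_one, Nat.add_sub_cancel] at h2 h3
      have : 0 < N ^ k := by positivity
      rw [pow_succ] at h2
      nlinarith

theorem Reachable.exists_adj_dist_lt {V : Type*} {G : SimpleGraph V} {v r : V}
    (hr : G.Reachable v r) (hne : v ≠ r) : ∃ w, G.Adj v w ∧ G.dist w r < G.dist v r := by
  obtain ⟨p, hp⟩ := hr.exists_walk_length_eq_dist
  cases p with
  | nil => exact absurd rfl hne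
  | cons hadj q =>
    refine ⟨_, hadj, ?_⟩
    have := dist_le q
    simp only [Walk.length_cons] at hp
    omega

open Finset Classical in
/-- In a finite graph with a root in each component `c`, there is a set `D` of at most
`∑ c, ⌊|c| / 2⌋` vertices such that every nonempty set avoiding `D` contains a vertex with less than
half of its neighbours in the set, or a root with at most half of them. -/
theorem exists_finset_forall_disjoint {V : Type*} [Fintype V] (H : SimpleGraph V)
    (r : H.ConnectedComponent → V) (hr : ∀ c, H.connectedComponentMk (r c) = c) :
    ∃ D : Finset V, #D ≤ ∑ c : H.ConnectedComponent, #{v | H.connectedComponentMk v = c} / 2 ∧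
      ∀ S : Finset V, S.Nonempty → Disjoint S D → ∃ v ∈ S,
        2 * #{w ∈ S | H.Adj v w} < H.degree v ∨
          (v = r (H.connectedComponentMk v) ∧ 2 * #{w ∈ S | H.Adj v w} ≤ H.degree v) := by
  set root : V → V := fun v => r (H.connectedComponentMk v) with hroot
  set h : V → ℕ := fun v => H.dist v (root v) with hh
  have hadj : ∀ v, ∃ w, v ≠ root v → H.Adj v w ∧ h w < h v := by
    intro v
    by_cases hv : v = root v
    · exact ⟨v, fun h' => absurd hv h'⟩
    · have hre : H.Reachable v (root v) := ConnectedComponent.exact (hr _).symm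
      obtain ⟨w, hw, hlt⟩ := hre.exists_adj_dist_lt hv
      refine ⟨w, fun _ => ⟨hw, ?_⟩⟩
      have : root w = root v := congrArg r (ConnectedComponent.sound hw.reachable.symm)
      simpa only [hh, this] using hlt
  choose p hp using hadj
  obtain ⟨s, hs⟩ := exists_cut_tie_parent H {v | v = root v} h p (fun v hv => (hp v hv).1)
    fun v hv => (hp v hv).2
  have hside : ∀ c : H.ConnectedComponent, ∃ σ : ℤˣ,
      #{v | H.connectedComponentMk v = c ∧ s v = σ} ≤ #{v | H.connectedComponentMk v = c} / 2 := by
    intro c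
    have hsum := card_filter_add_card_filter_not (s := {v | H.connectedComponentMk v = c})
      (fun v => s v = 1)
    simp only [filter_filter] at hsum
    by_cases h1 : #{v | H.connectedComponentMk v = c ∧ s v = 1} ≤
        #{v | H.connectedComponentMk v = c} / 2
    · exact ⟨1, h1⟩
    · refine ⟨-1, ?_⟩
      have : #{v | H.connectedComponentMk v = c ∧ s v = -1} =
          #{v | H.connectedComponentMk v = c ∧ ¬ s v = 1} := by
        congr 1
        ext v
        rcases Int.units_eq_one_or (s v) with h2 | h2 <;> simp [h2]
      omega
  choose σ hσ using hside
  refine ⟨univ.filter fun v => s v = σ (H.connectedComponentMk v), ?_, ?_⟩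
  · rw [card_eq_sum_card_fiberwise (f := H.connectedComponentMk) (t := univ) (by simp)]
    refine sum_le_sum fun c _ => le_trans (card_le_card ?_) (hσ c)
    intro v
    simp only [mem_filter, mem_univ, true_and]
    rintro ⟨h1, rfl⟩
    exact ⟨rfl, h1⟩
  · intro S hne hdisj
    obtain ⟨v, hv, hmin⟩ := S.exists_min_image h hne
    refine ⟨v, hv, ?_⟩
    have hS : ∀ w ∈ S, s w ≠ σ (H.connectedComponentMk w) := by
      intro w hw h1
      exact Finset.disjoint_left.1 hdisj hw (by simpa using h1)
    have hsub : {w ∈ S | H.Adj v w} ⊆ ({w | H.Adj v w ∧ s w = s v} : Finset V) := by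
      intro w hw
      simp only [mem_filter, mem_univ, true_and] at hw ⊢
      refine ⟨hw.2, ?_⟩
      have h1 := hS w hw.1
      have h2 := hS v hv
      have h3 : H.connectedComponentMk w = H.connectedComponentMk v :=
        ConnectedComponent.sound hw.2.reachable.symm
      rw [h3] at h1
      rw [Int.units_ne_iff_eq_neg] at h1 h2
      rw [h1, h2]
    have hle := card_le_card hsub
    have hdeg : #{w | H.Adj v w ∧ s w = s v} + #{w | H.Adj v w ∧ s w ≠ s v} = H.degree v := by
      rw [← card_neighborFinset_eq_degree, neighborFinset_eq_filter,
        ← card_filter_add_card_filter_not (s := {w | H.Adj v w}) (fun w => s w = s v)]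
      simp only [filter_filter, ne_eq]
    obtain ⟨h1, h2⟩ := hs v
    by_contra! hcon
    have heq : #{w | H.Adj v w ∧ s w = s v} = #{w | H.Adj v w ∧ s w ≠ s v} := by omega
    have hnr : v ≠ root v := by
      intro hv'
      have := hcon.2 hv'
      omega
    have hpar := h2 heq hnr
    have hSeq := eq_of_subset_of_card_le hsub (by omega)
    have hmem : p v ∈ S := by
      have : p v ∈ ({w | H.Adj v w ∧ s w = s v} : Finset V) := by simp [(hp v hnr).1, hpar]
      rw [← hSeq] at this
      exact (mem_filter.1 this).1
    exact absurd (hmin _ hmem) (not_le.2 (hp v hnr).2)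

/-! ### From stuck sets to dynamos -/

theorem activeAfter_mono {V : Type*} (G : SimpleGraph V) (τ : V → ℕ) (D : Set V) :
    Monotone (G.activeAfter τ D) :=
  monotone_nat_of_le_succ fun _ => Set.subset_union_left

open Finset Classical in
/-- `D` is a strict majority dynamo if every nonempty set avoiding `D` contains a vertex with less
than half of its neighbours in the set. -/
theorem isStrictMajorityDynamo_of_forall_disjoint {V : Type*} [Fintype V] (G : SimpleGraph V)
    [DecidableRel G.Adj] (D : Finset V)
    (hD : ∀ S : Finset V, S.Nonempty → Disjoint S D →
      ∃ v ∈ S, 2 * #{w ∈ S | G.Adj v w} < G.degree v) :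
    G.IsStrictMajorityDynamo (D : Set V) := by
  set A : ℕ → Set V := G.activeAfter G.strictMajorityThreshold D with hA
  by_contra hcon
  have hne : ∃ v, v ∉ ⋃ i, A i := by
    by_contra! h
    exact hcon (Set.eq_univ_of_forall h)
  obtain ⟨v, hv, hlt⟩ := hD {v | v ∉ ⋃ i, A i} (by simpa [Finset.Nonempty] using hne) (by
    rw [Finset.disjoint_left]
    intro v hv hvD
    simp only [mem_filter, mem_univ, true_and] at hv
    exact hv (Set.mem_iUnion.2 ⟨0, hvD⟩))
  simp only [mem_filter, mem_univ, true_and] at hv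
  -- By finiteness, a single stage `i` already contains every neighbour of `v` that ever becomes
  -- active.
  obtain ⟨i, hi⟩ := (activeAfter_mono G G.strictMajorityThreshold
    (D : Set V)).directed_le.exists_mem_subset_of_finset_subset_biUnion
    (s := ({w | w ∈ ⋃ i, A i ∧ G.Adj v w} : Finset V)) (by
      intro w hw
      have := (mem_filter.1 hw).2.1
      simpa using this)
  refine hv (Set.mem_iUnion.2 ⟨i + 1, Or.inr ?_⟩)
  have hsum := card_filter_add_card_filter_not (s := {w | G.Adj v w}) (fun w => w ∈ ⋃ i, A i)
  rw [← neighborFinset_eq_filter, card_neighborFinset_eq_degree, neighborFinset_eq_filter,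
    filter_filter, filter_filter] at hsum
  have e1 : #{w | G.Adj v w ∧ w ∈ ⋃ i, A i} ≤ (G.neighborSet v ∩ A i).ncard := by
    rw [← Set.ncard_coe_finset]
    refine Set.ncard_le_ncard (fun w hw => ?_) (Set.toFinite _)
    simp only [coe_filter, mem_univ, true_and, Set.mem_ofPred_eq] at hw
    exact ⟨hw.1, hi (by simpa [and_comm] using hw)⟩
  have e2 : #{w ∈ ({v | v ∉ ⋃ i, A i} : Finset V) | G.Adj v w} =
      #{w | G.Adj v w ∧ ¬ w ∈ ⋃ i, A i} := by
    rw [filter_filter]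
    simp only [and_comm]
  have e3 : G.degree v + 1 ≤ 2 * (G.neighborSet v ∩ A i).ncard := by omega
  show ⌈((G.degree v : ℚ) + 1) / 2⌉₊ ≤ (G.neighborSet v ∩ A i).ncard
  rw [Nat.ceil_le]
  have : ((G.degree v + 1 : ℕ) : ℚ) ≤ (2 * (G.neighborSet v ∩ A i).ncard : ℕ) := by
    exact_mod_cast e3
  push_cast at this
  linarith

/-! ### Tutte–Berge from Tutte's theorem -/

/-- The graph obtained from `G` by deleting all edges that meet `U`. -/
def isolate {V : Type*} (G : SimpleGraph V) (U : Set V) : SimpleGraph V where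
  Adj u v := G.Adj u v ∧ u ∉ U ∧ v ∉ U
  symm := ⟨fun _ _ h => ⟨h.1.symm, h.2.2, h.2.1⟩⟩
  loopless := ⟨fun _ h => h.1.ne rfl⟩

/-- The join of `G` with a clique on the vertex set `W`. -/
def joinClique {V : Type*} (G : SimpleGraph V) (W : Type*) : SimpleGraph (V ⊕ W) where
  Adj x y := x ≠ y ∧ ∀ u v, x = Sum.inl u → y = Sum.inl v → G.Adj u v
  symm := ⟨fun _ _ h => ⟨h.1.symm, fun u v hu hv => (h.2 v u hv hu).symm⟩⟩
  loopless := ⟨fun _ h => h.1 rfl⟩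

@[simp]
theorem joinClique_adj_inl_inl {V W : Type*} {G : SimpleGraph V} {u v : V} :
    (G.joinClique W).Adj (Sum.inl u) (Sum.inl v) ↔ G.Adj u v := by
  refine ⟨fun h => h.2 u v rfl rfl, fun h => ⟨fun h' => h.ne (Sum.inl_injective h'), ?_⟩⟩
  rintro a b ha hb
  cases ha
  cases hb
  exact h

theorem joinClique_adj_inr {V W : Type*} {G : SimpleGraph V} {x : V ⊕ W} {w : W}
    (hx : x ≠ Sum.inr w) : (G.joinClique W).Adj x (Sum.inr w) :=
  ⟨hx, fun _ _ _ h => by cases h⟩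

section Embedding

variable {W V : Type*} {K : SimpleGraph W} {H : SimpleGraph V} {f : K ↪g H}

/-- No walk leaves a range closed under adjacency, so walks lift along `f`. -/
theorem exists_reachable_of_reachable_embedding
    (hf : ∀ x z, H.Adj (f x) z → z ∈ Set.range f) {x : W} {z : V} (h : H.Reachable (f x) z) :
    ∃ y, f y = z ∧ K.Reachable x y := by
  obtain ⟨p⟩ := h
  generalize hu : f x = u at p
  induction p generalizing x with
  | nil => exact ⟨x, hu, Reachable.refl _⟩
  | cons hadj _ ih =>
    subst hu
    obtain ⟨y, rfl⟩ := hf _ _ hadj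
    obtain ⟨y', h1, h2⟩ := ih rfl
    exact ⟨y', h1, (f.map_adj_iff.1 hadj).reachable.trans h2⟩

theorem ConnectedComponent.map_injective_of_range_closed
    (hf : ∀ x z, H.Adj (f x) z → z ∈ Set.range f) :
    Function.Injective (ConnectedComponent.map f.toHom) := by
  intro c c'
  refine ConnectedComponent.ind₂ (fun x x' h => ?_) c c'
  obtain ⟨y, hy, hr⟩ := exists_reachable_of_reachable_embedding hf (ConnectedComponent.exact h)
  rw [f.injective hy] at hr
  exact ConnectedComponent.sound hr

theorem ConnectedComponent.supp_map_of_range_closed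
    (hf : ∀ x z, H.Adj (f x) z → z ∈ Set.range f) (c : K.ConnectedComponent) :
    (c.map f.toHom).supp = f '' c.supp := by
  refine c.ind fun x => ?_
  ext z
  simp only [ConnectedComponent.map_mk, ConnectedComponent.mem_supp_iff, Set.mem_image]
  constructor
  · intro h
    obtain ⟨y, hy, hr⟩ := exists_reachable_of_reachable_embedding hf (ConnectedComponent.exact h).symm
    exact ⟨y, ConnectedComponent.sound hr.symm, hy⟩
  · rintro ⟨y, hy, rfl⟩
    exact ConnectedComponent.sound ((ConnectedComponent.exact hy).map f.toHom)

end Embedding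

theorem supp_connectedComponentMk_isolate {V : Type*} {G : SimpleGraph V} {U : Set V} {u : V}
    (hu : u ∈ U) : ((G.isolate U).connectedComponentMk u).supp = {u} := by
  ext v
  simp only [ConnectedComponent.mem_supp_iff, Set.mem_singleton_iff]
  constructor
  · intro h
    obtain ⟨p⟩ := (ConnectedComponent.exact h).symm
    cases p with
    | nil => rfl
    | cons h _ => exact absurd hu h.2.1
  · rintro rfl; rfl

/-- Deleting the clique and the set `U` from `G.joinClique W` leaves a graph whose odd components
are the odd components of `G.isolate U` other than the vertices of `U`. -/
theorem ncard_oddComponents_deleteVerts_joinClique_add_le {V W : Type*} [Finite V] [Finite W]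
    (G : SimpleGraph V) (T : Set (V ⊕ W)) (hT : ∀ w, Sum.inr w ∈ T) :
    ((⊤ : (G.joinClique W).Subgraph).deleteVerts T).coe.oddComponents.ncard +
      (Sum.inl ⁻¹' T).ncard ≤ (G.isolate (Sum.inl ⁻¹' T)).oddComponents.ncard := by
  set U : Set V := Sum.inl ⁻¹' T with hU
  set K := ((⊤ : (G.joinClique W).Subgraph).deleteVerts T).coe with hK
  have hex : ∀ x : ((⊤ : (G.joinClique W).Subgraph).deleteVerts T).verts,
      ∃ v, x.1 = Sum.inl v := by
    rintro ⟨v | w, hx⟩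
    · exact ⟨v, rfl⟩
    · exact absurd (hT w) hx.2
  choose φ hφ using hex
  have hφU : ∀ x, φ x ∉ U := fun x hx => x.2.2 (by rw [hφ x]; exact hx)
  let f : K ↪g G.isolate U :=
    { toFun := φ
      inj' := fun x y hxy => Subtype.ext (by rw [hφ, hφ, hxy])
      map_rel_iff' := by
        intro x y
        change (G.Adj (φ x) (φ y) ∧ φ x ∉ U ∧ φ y ∉ U) ↔ K.Adj x y
        have h1 := x.2.2
        have h2 := y.2.2
        rw [hK, Subgraph.coe_adj, Subgraph.deleteVerts_adj]
        simp only [Subgraph.verts_top, Set.mem_univ, true_and, Subgraph.top_adj, h1, h2,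
          not_false_eq_true, hφU, and_true]
        rw [hφ x, hφ y, joinClique_adj_inl_inl] }
  have hrange : ∀ v, v ∉ U → v ∈ Set.range f := by
    intro v hv
    refine ⟨⟨Sum.inl v, Set.mem_univ _, hv⟩, ?_⟩
    exact (Sum.inl_injective (hφ ⟨Sum.inl v, Set.mem_univ _, hv⟩)).symm
  have hf : ∀ x z, (G.isolate U).Adj (f x) z → z ∈ Set.range f :=
    fun x z h => hrange z h.2.2
  have h1 : (ConnectedComponent.map f.toHom '' K.oddComponents).ncard = K.oddComponents.ncard :=
    Set.ncard_image_of_injective _ (ConnectedComponent.map_injective_of_range_closed hf)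
  have h2 : ((G.isolate U).connectedComponentMk '' U).ncard = U.ncard := by
    refine Set.InjOn.ncard_image fun u hu v _ huv => ?_
    have : v ∈ ((G.isolate U).connectedComponentMk u).supp := huv.symm
    rw [supp_connectedComponentMk_isolate hu] at this
    exact this.symm
  rw [← h1, ← h2, ← Set.ncard_union_eq _ (Set.toFinite _) (Set.toFinite _)]
  · refine Set.ncard_le_ncard ?_ (Set.toFinite _)
    rintro _ (⟨c, hc, rfl⟩ | ⟨u, hu, rfl⟩)
    · change Odd _
      rw [ConnectedComponent.supp_map_of_range_closed hf, Set.ncard_image_of_injective _ f.injective]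
      exact hc
    · change Odd _
      rw [supp_connectedComponentMk_isolate hu, Set.ncard_singleton]
      exact odd_one
  · rw [Set.disjoint_left]
    rintro _ ⟨c, _, rfl⟩ ⟨u, hu, h⟩
    have h3 : u ∈ (ConnectedComponent.map f.toHom c).supp := h
    rw [ConnectedComponent.supp_map_of_range_closed hf] at h3
    obtain ⟨x, _, rfl⟩ := h3
    exact hφU x hu

/-- A surviving clique vertex is adjacent to every other survivor, so what remains is connected. -/
theorem ncard_oddComponents_deleteVerts_joinClique_le_one {V W : Type*} [Finite V] [Finite W]
    (G : SimpleGraph V) (T : Set (V ⊕ W)) {w : W} (hw : Sum.inr w ∉ T) :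
    ((⊤ : (G.joinClique W).Subgraph).deleteVerts T).coe.oddComponents.ncard ≤ 1 := by
  set K := ((⊤ : (G.joinClique W).Subgraph).deleteVerts T).coe with hK
  have h : ∀ c : K.ConnectedComponent,
      c = K.connectedComponentMk ⟨Sum.inr w, Set.mem_univ _, hw⟩ := by
    refine ConnectedComponent.ind fun x => ConnectedComponent.sound ?_
    by_cases hx : x.1 = Sum.inr w
    · rw [show x = ⟨Sum.inr w, Set.mem_univ _, hw⟩ from Subtype.ext hx]
    · refine Adj.reachable ?_
      rw [hK, Subgraph.coe_adj, Subgraph.deleteVerts_adj]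
      exact ⟨x.2.1, x.2.2, Set.mem_univ _, hw, joinClique_adj_inr hx⟩
  exact (Set.ncard_le_one (Set.toFinite _)).2 fun a _ b _ => (h a).trans (h b).symm

theorem ncard_verts_le_two_mul_ncard_edgeSet_of_isMatching {V : Type*} [Finite V]
    {G : SimpleGraph V} {M : G.Subgraph} (hM : M.IsMatching) :
    M.verts.ncard ≤ 2 * M.edgeSet.ncard := by
  classical
  have := Fintype.ofFinite V
  have hsub : M.verts ⊆ (M.edgeSet.toFinset.biUnion Sym2.toFinset : Finset V) := by
    intro v hv
    obtain ⟨w, hw, -⟩ := hM hv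
    exact Finset.mem_biUnion.2 ⟨s(v, w), by simpa using hw, by simp⟩
  refine (Set.ncard_le_ncard hsub (Set.toFinite _)).trans ?_
  rw [Set.ncard_coe_finset, Set.ncard_eq_toFinset_card', mul_comm]
  refine Finset.card_biUnion_le_card_mul _ _ _ fun e _ => ?_
  rw [Sym2.card_toFinset]
  split_ifs <;> omega

/-- A perfect matching of the join of `G` with a clique on `d` vertices restricts to a matching of
`G` that misses at most `d` vertices. -/
theorem card_le_two_mul_matchingNumber_add_of_isPerfectMatching {V W : Type*} [Finite V] [Finite W]
    (G : SimpleGraph V) {M : (G.joinClique W).Subgraph} (hM : M.IsPerfectMatching) :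
    Nat.card V ≤ 2 * G.matchingNumber + Nat.card W := by
  classical
  let M' : G.Subgraph :=
    { verts := {v | ∃ w, M.Adj (Sum.inl v) (Sum.inl w)}
      Adj := fun v w => M.Adj (Sum.inl v) (Sum.inl w)
      adj_sub := fun h => joinClique_adj_inl_inl.1 (M.adj_sub h)
      edge_vert := fun h => ⟨_, h⟩
      symm := ⟨fun _ _ h => M.adj_symm h⟩ }
  have hM' : M'.IsMatching := by
    rintro v ⟨w, hw⟩
    exact ⟨w, hw, fun y hy => Sum.inl_injective (hM.1.eq_of_adj_left hy hw)⟩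
  have h1 : M'.edgeSet.ncard ≤ G.matchingNumber :=
    G.isGreatest_matchingNumber.2 ⟨M', hM', rfl⟩
  have h2 := ncard_verts_le_two_mul_ncard_edgeSet_of_isMatching hM'
  have hex : ∀ v : (M'.vertsᶜ : Set V), ∃ w : W, M.Adj (Sum.inl v.1) (Sum.inr w) := by
    rintro ⟨v, hv⟩
    obtain ⟨x | w, hx, -⟩ := hM.1 (hM.2 (Sum.inl v))
    · exact absurd ⟨x, hx⟩ hv
    · exact ⟨w, hx⟩
  choose g hg using hex
  have hinj : Function.Injective g := by
    intro v v' h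
    have h3 := hg v'
    rw [← h] at h3
    exact Subtype.ext (Sum.inl_injective (hM.1.eq_of_adj_right (hg v) h3))
  have h3 := Nat.card_le_card_of_injective g hinj
  rw [Nat.card_coe_set_eq] at h3
  have h4 := Set.ncard_add_ncard_compl M'.verts
  omega

/-- The nontrivial inequality of the **Tutte–Berge formula**. -/
theorem exists_two_mul_ncard_add_card_le {V : Type*} [Finite V] (G : SimpleGraph V) :
    ∃ U : Set V, 2 * U.ncard + Nat.card V ≤
      2 * G.matchingNumber + (G.isolate U).oddComponents.ncard := by
  classical
  -- Vertices of `U` stay as odd singleton components, so the usual deficiency takes a factor 2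
  -- here.
  obtain ⟨U, hU⟩ := Finite.exists_max fun U : Set V =>
    ((G.isolate U).oddComponents.ncard : ℤ) - 2 * U.ncard
  refine ⟨U, ?_⟩
  obtain ⟨d, hd⟩ : ∃ d : ℕ, (d : ℤ) = (G.isolate U).oddComponents.ncard - 2 * U.ncard := by
    have h := hU ∅
    simp only [Set.ncard_empty] at h
    exact ⟨_, Int.toNat_of_nonneg (by omega)⟩
  have hpar := (G.isolate U).odd_ncard_oddComponents
  have htutte : ∀ T, ¬ (G.joinClique (Fin d)).IsTutteViolator T := by
    intro T hT
    rw [IsTutteViolator] at hT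
    by_cases hw : ∀ w, Sum.inr w ∈ T
    · have h1 := ncard_oddComponents_deleteVerts_joinClique_add_le G T hw
      have h2 := hU (Sum.inl ⁻¹' T)
      have h3 : (Sum.inl ⁻¹' T : Set V).ncard + d ≤ T.ncard := by
        have h4 : (Sum.inl '' (Sum.inl ⁻¹' T : Set V) ∪ Set.range (Sum.inr : Fin d → V ⊕ Fin d)) ⊆
            T := by
          rintro _ (⟨v, hv, rfl⟩ | ⟨w, rfl⟩)
          · exact hv
          · exact hw w
        have h5 := Set.ncard_le_ncard h4 (Set.toFinite _)
        rw [Set.ncard_union_eq _ (Set.toFinite _) (Set.toFinite _),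
          Set.ncard_image_of_injective _ Sum.inl_injective, ← Set.image_univ,
          Set.ncard_image_of_injective _ Sum.inr_injective, Set.ncard_univ, Nat.card_fin] at h5
        · exact h5
        · rw [Set.disjoint_left]
          rintro _ ⟨v, _, rfl⟩ ⟨w, h⟩
          cases h
      omega
    -- A violator missing a clique vertex must be empty, which would make `Nat.card V + d` odd; but
    -- `d` has the parity of `Nat.card V`.
    · push Not at hw
      obtain ⟨w, hw⟩ := hw
      have h1 := ncard_oddComponents_deleteVerts_joinClique_le_one G T hw
      have h2 : T.ncard = 0 := by omega
      have h3 : T = ∅ := (Set.ncard_eq_zero (Set.toFinite _)).1 h2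
      subst h3
      have h4 : Odd (((⊤ : (G.joinClique (Fin d)).Subgraph).deleteVerts
          ∅).coe.oddComponents.ncard) := by
        rw [Set.ncard_empty] at hT
        rw [le_antisymm h1 hT]
        exact odd_one
      rw [odd_ncard_oddComponents] at h4
      have h5 : Nat.card ((⊤ : (G.joinClique (Fin d)).Subgraph).deleteVerts ∅).verts =
          Nat.card V + d := by
        rw [Nat.card_coe_set_eq]
        simp [Set.ncard_univ, Nat.card_sum]
      rw [h5] at h4
      rw [Nat.odd_iff] at h4
      rw [Nat.odd_iff, Nat.odd_iff] at hpar
      omega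
  obtain ⟨M, hM⟩ := tutte.2 htutte
  have h := card_le_two_mul_matchingNumber_add_of_isPerfectMatching G hM
  rw [Nat.card_fin] at h
  omega

/-! ### Counting and assembly -/

open Finset Classical in
theorem two_mul_sum_card_div_two_add_ncard_oddComponents {V : Type*} [Fintype V]
    (H : SimpleGraph V) :
    2 * ∑ c : H.ConnectedComponent, #{v | H.connectedComponentMk v = c} / 2 +
      H.oddComponents.ncard = Fintype.card V := by
  have hsupp : ∀ c : H.ConnectedComponent, c.supp.ncard = #{v | H.connectedComponentMk v = c} := by
    intro c
    rw [← Set.ncard_coe_finset]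
    congr 1
    ext v
    simp
  have hodd : H.oddComponents.ncard =
      ∑ c : H.ConnectedComponent, #{v | H.connectedComponentMk v = c} % 2 := by
    rw [show H.oddComponents = ((univ.filter fun c : H.ConnectedComponent =>
      Odd #{v | H.connectedComponentMk v = c} : Finset _) : Set _) by ext c; simp [hsupp],
      Set.ncard_coe_finset, card_filter]
    refine sum_congr rfl fun c _ => ?_
    split_ifs with h
    · exact (Nat.odd_iff.1 h).symm
    · exact (Nat.even_iff.1 (Nat.not_odd_iff_even.1 h)).symm
  rw [hodd, mul_sum, ← sum_add_distrib, ← card_univ,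
    card_eq_sum_card_fiberwise (f := H.connectedComponentMk) (t := univ) (by simp)]
  exact sum_congr rfl fun c _ => Nat.div_add_mod _ 2

/-- A component untouched by `U` loses no edges, so a walk of `G` cannot leave it. -/
theorem connectedComponent_isolate_eq_of_reachable {V : Type*} {G : SimpleGraph V} {U : Set V}
    {u v : V} (h : G.Reachable u v) (c : (G.isolate U).ConnectedComponent)
    (hu : (G.isolate U).connectedComponentMk u = c)
    (hc : ∀ w ∈ c.supp, w ∉ U ∧ ∀ x ∈ U, ¬ G.Adj w x) :
    (G.isolate U).connectedComponentMk v = c := by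
  obtain ⟨p⟩ := h
  induction p with
  | nil => exact hu
  | cons hadj _ ih =>
    refine ih ?_
    obtain ⟨h1, h2⟩ := hc _ hu
    rw [← hu]
    exact ConnectedComponent.sound
      (Adj.reachable ⟨hadj.symm, fun hx => h2 _ hx hadj, h1⟩)

open Finset Classical in
/-- A finite graph has a strict majority dynamo whose size is at most the matching number plus the
number of components. -/
theorem exists_isStrictMajorityDynamo_card_le {V : Type*} [Fintype V] (G : SimpleGraph V)
    [DecidableRel G.Adj] :
    ∃ D : Finset V, G.IsStrictMajorityDynamo (D : Set V) ∧
      #D ≤ G.matchingNumber + Nat.card G.ConnectedComponent := by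
  obtain ⟨U, hU⟩ := G.exists_two_mul_ncard_add_card_le
  set H := G.isolate U with hH
  -- Roots are taken adjacent to `U` whenever the component allows it.
  have hroot : ∀ c : H.ConnectedComponent, ∃ v, H.connectedComponentMk v = c ∧
      ((∃ w ∈ c.supp, ∃ x ∈ U, G.Adj w x) → ∃ x ∈ U, G.Adj v x) := by
    intro c
    by_cases h : ∃ w ∈ c.supp, ∃ x ∈ U, G.Adj w x
    · obtain ⟨w, hw, hx⟩ := h
      exact ⟨w, hw, fun _ => hx⟩
    · obtain ⟨v, hv⟩ := c.exists_rep
      exact ⟨v, hv, fun h' => absurd h' h⟩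
  choose r hr hrU using hroot
  obtain ⟨D, hDcard, hD⟩ := H.exists_finset_forall_disjoint r hr
  set C : Finset H.ConnectedComponent := {c | ∀ w ∈ c.supp, w ∉ U ∧ ∀ x ∈ U, ¬ G.Adj w x} with hC
  have hCcard : #C ≤ Nat.card G.ConnectedComponent := by
    rw [Nat.card_eq_fintype_card, ← card_univ]
    refine card_le_card_of_injOn (fun c => G.connectedComponentMk (r c)) (by simp) ?_
    intro c hc c' _ h
    have hc := (mem_filter.1 (mem_coe.1 hc)).2
    rw [← connectedComponent_isolate_eq_of_reachable (ConnectedComponent.exact h) c (hr c) hc]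
    exact hr c'
  refine ⟨U.toFinset ∪ D ∪ C.image r, ?_, ?_⟩
  · refine isStrictMajorityDynamo_of_forall_disjoint G _ fun S hne hdisj => ?_
    rw [disjoint_union_right, disjoint_union_right] at hdisj
    obtain ⟨⟨hSU, hSD⟩, hSC⟩ := hdisj
    have hSU : ∀ w ∈ S, w ∉ U := fun w hw hwU =>
      Finset.disjoint_left.1 hSU hw (Set.mem_toFinset.2 hwU)
    obtain ⟨v, hv, hcase⟩ := hD S hne hSD
    refine ⟨v, hv, ?_⟩
    have heq : #{w ∈ S | G.Adj v w} = #{w ∈ S | H.Adj v w} := by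
      congr 1
      refine filter_congr fun w hw => ?_
      exact ⟨fun h => ⟨h, hSU v hv, hSU w hw⟩, fun h => h.1⟩
    have hsub : H.neighborFinset v ⊆ G.neighborFinset v := by
      intro w hw
      rw [mem_neighborFinset] at hw ⊢
      exact hw.1
    have hdeg : H.degree v ≤ G.degree v := card_le_card hsub
    rw [heq]
    rcases hcase with h | ⟨hvr, h⟩
    · omega
    -- The root may be tied in `H`; an edge of `G` to `U`, lost in `H`, makes the inequality strict.
    · suffices H.degree v < G.degree v by omega
      set c := H.connectedComponentMk v with hc
      have hcC : c ∉ C := fun h' =>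
        Finset.disjoint_left.1 hSC hv (mem_image.2 ⟨c, h', hvr.symm⟩)
      have htouch : ∃ w ∈ c.supp, ∃ x ∈ U, G.Adj w x := by
        by_contra! hcon
        refine hcC (mem_filter.2 ⟨mem_univ _, fun w hw => ⟨fun hwU => ?_, hcon w hw⟩⟩)
        have h1 : v ∈ (H.connectedComponentMk w).supp := by
          rw [ConnectedComponent.mem_supp_iff] at hw ⊢
          exact hw.symm
        rw [supp_connectedComponentMk_isolate hwU] at h1
        exact hSU v hv (h1 ▸ hwU)
      obtain ⟨x, hx, hadj⟩ := hrU c htouch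
      rw [← hvr] at hadj
      refine card_lt_card ((ssubset_iff_of_subset hsub).2 ⟨x, ?_, ?_⟩)
      · rwa [mem_neighborFinset]
      · rw [mem_neighborFinset]
        exact fun h' => h'.2.2 hx
  · have h1 := H.two_mul_sum_card_div_two_add_ncard_oddComponents
    have h2 : #(C.image r) ≤ #C := card_image_le
    have h3 := card_union_le (U.toFinset ∪ D) (C.image r)
    have h4 := card_union_le U.toFinset D
    have h5 : #U.toFinset = U.ncard := (Set.ncard_eq_toFinset_card' U).symm
    rw [Nat.card_eq_fintype_card] at hU
    omega

end SimpleGraph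

theorem mainTheorem1 {V : Type*} [Fintype V] (G : SimpleGraph V) [DecidableRel G.Adj] :
    (G.Connected →
      ∃ D : Finset V, G.IsStrictMajorityDynamo (D : Set V) ∧ D.card ≤ G.matchingNumber + 1) ∧
    (∀ c : ℕ, Nat.card G.ConnectedComponent = c →
      ∃ D : Finset V, G.IsStrictMajorityDynamo (D : Set V) ∧ D.card ≤ G.matchingNumber + c) := by
  have key := G.exists_isStrictMajorityDynamo_card_le
  refine ⟨fun hG => ?_, fun c hc => hc ▸ key⟩
  have : Nat.card G.ConnectedComponent = 1 := by
    have := hG.preconnected.subsingleton_connectedComponent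
    have := hG.nonempty.map G.connectedComponentMk
    exact Nat.card_eq_one_iff_unique.2 ⟨‹_›, ‹_›⟩
  exact this ▸ key
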